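/- **Setting.** Let $X$ be a set of arms and let $\mathcal D$ be a similarity function on $X$. Each arm $x\in X$ has a reward distribution $\mathbb P_x$ on $[0,1]$ with mean $\mu(x)$. In each round an algorithm plays an arm, chosen from its past observations and possibly internal randomness, and receives a reward which, conditionally on the history and on the chosen arm $x$, has law $\mathbb P_x$. Write $\mu^*=\sup_{x\in X}\mu(x)$ and $\Delta(x)=\mu^*-\mu(x)$. If $x_s$ is the arm played in round $s$, the regret is $R(t)=t\,\mu^*-\mathbb E\big[\sum_{s=1}^t\mu(x_s)\big]$. **Zooming algorithm.** The algorithm proceeds in phases $i=1,2,3,\dots$, where phase $i$ lasts $2^i$ rounds, and it forgets everything at the start of a phase. At a given round $t$ of phase $i$, let $n_t(x)$ be the number of earlier rounds of this phase in which $x$ was played, let $\mu_t(x)$ be the average of the rewards received in them ($0$ if $n_t(x)=0$), and let $r_t(x)=\sqrt{8i/(1+n_t(x))}$. No arm is active at the start of a phase. In each round: * *Activation:* if some arm $w$ is not covered, i.e. $\mathcal D(z,w)\ge r_t(z)$ for every active arm $z$, pick any one such arm and activate it (it stays active until the end of the phase). * *Selection:* play any active arm $x$ that maximizes the index $I_t(x)=\mu_t(x)+2r_t(x)$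 over the active arms. **Zooming dimension.** For $c>0$, the zooming dimension with multiplier $c$ is the smallest $d\ge 0$ such that for every $r\in(0,1]$ the set $\{x\in X:\ r/2<\Delta(x)\le r\}$ can be covered by at most $c\,r^{-d}$ sets of diameter strictly less than $r/8$ (the diameter of a set is the supremum of $\mathcal D$ over pairs of its points). **Theorem.** There is an absolute constant $C>0$ such that the following holds, whatever choices the algorithm makes among uncovered arms and among arms of maximal index. 1. Suppose that $(X,\mathcal D)$ is a metric space and $|\mu(x)-\mu(y)|\le\mathcal D(x,y)$ for all $x,y\in X$. For every $c>0$, if $d$ is the zooming dimension with multiplier $c$, then the regret of the zooming algorithm satisfies $$R(t)\ \le\ (C\,c\log t)^{\frac1{d+2}}\; t^{\frac{d+1}{d+2}}\qquad\text{for all } t\ge 2 .$$ 2. The same bound, for all $c>0$ and all $t\ge 2$, holds if $\mathcal D:X\times X\to[0,\infty]$ is only assumed to be symmetric with $\mathcal D(x,x)=0$ for all $x$ (no triangle inequality), and the Lipschitz condition is relaxed to: for every $\varepsilon>0$ there is $x^*\in X$ such that $\Delta(x)\le\mathcal D(x,x^*)+\varepsilon$ for all $x\in X$. -/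

import Mathlib

open MeasureTheory ProbabilityTheory Set
open scoped ENNReal

universe u v

namespace Zooming

noncomputable section

/-! ### Problem instance

`X` is the set of arms and `D : X → X → ℝ≥0∞` the similarity function. The reward of arm `x` has
law `P x` on `[0,1]`; here `P` is a Markov kernel for some σ-algebra on `X` (for instance the Borel
one, or the discrete one, for which every family of laws is a kernel). -/

/-- Expected payoff `μ(x)` of the arm `x`. -/
def meanPayoff {X : Type u} [MeasurableSpace X] (P : Kernel X ℝ) (x : X) : ℝ :=
  ∫ y, y ∂(P x)

/-- The badness `Δ(x) = sup μ - μ(x)`. -/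
def badness {X : Type u} (μ : X → ℝ) (x : X) : ℝ :=
  (⨆ z, μ z) - μ x

/-- A symmetric function `X × X → [0,∞]` that vanishes on the diagonal (no triangle inequality). -/
structure IsQuasiMetric {X : Type u} (D : X → X → ℝ≥0∞) : Prop where
  symm : ∀ x y, D x y = D y x
  self : ∀ x, D x x = 0

/-- The Lipschitz condition relative to an approximately optimal arm. -/
def RelaxedLipschitz {X : Type u} (D : X → X → ℝ≥0∞) (μ : X → ℝ) : Prop :=
  ∀ ε : ℝ, 0 < ε → ∃ xs : X, ∀ x : X,
    ENNReal.ofReal (badness μ x) ≤ D x xs + ENNReal.ofReal ε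

/-! ### Zooming dimension -/

/-- Diameter of a set with respect to `D`: the supremum of the pairwise distances. -/
def diam {X : Type u} (D : X → X → ℝ≥0∞) (S : Set X) : ℝ≥0∞ :=
  ⨆ x ∈ S, ⨆ y ∈ S, D x y

/-- The near-optimal arms at scale `r`. -/
def nearOptimal {X : Type u} (μ : X → ℝ) (r : ℝ) : Set X :=
  {x | r / 2 < badness μ x ∧ badness μ x ≤ r}

/-- For each scale `r ∈ (0,1]`, the near-optimal arms at scale `r` can be covered by at most
`c * r ^ (-d)` sets of diameter strictly less than `r / 8`. -/
def ZoomingCovering {X : Type u} (D : X → X → ℝ≥0∞) (μ : X → ℝ) (c d : ℝ) : Prop :=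
  ∀ r : ℝ, 0 < r → r ≤ 1 → ∃ F : Finset (Set X),
    (F.card : ℝ) ≤ c * r ^ (-d) ∧
    (∀ S ∈ F, diam D S < ENNReal.ofReal (r / 8)) ∧
    nearOptimal μ r ⊆ ⋃ S ∈ F, S

/-- `d` is the zooming dimension with multiplier `c`: the smallest `d ≥ 0` with the covering
property. -/
def IsZoomingDim {X : Type u} (D : X → X → ℝ≥0∞) (μ : X → ℝ) (c d : ℝ) : Prop :=
  IsLeast {d' : ℝ | 0 ≤ d' ∧ ZoomingCovering D μ c d'} d

/-! ### The zooming algorithm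

Rounds are numbered `0, 1, 2, …` across all phases. A path is a sequence `x` of played arms
together with the sequence `y` of the rewards received. -/

/-- The phase `i = 1, 2, 3, …` to which round `t` belongs. Phase `i` lasts `2 ^ i` rounds, so it
consists of the rounds `t` with `2 ^ i - 2 ≤ t < 2 ^ (i + 1) - 2`. -/
def phase (t : ℕ) : ℕ := Nat.log 2 (t + 2)

/-- The first round of the phase to which round `t` belongs. -/
def phaseStart (t : ℕ) : ℕ := 2 ^ phase t - 2

open Classical in
/-- The rounds of the current phase, before round `t`, in which the arm `z` was played. -/
def plays {X : Type u} (x : ℕ → X) (t : ℕ) (z : X) : Finset ℕ :=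
  (Finset.Ico (phaseStart t) t).filter (fun s => x s = z)

/-- Average reward `μ_t(z)` of the arm `z` in the current phase before round `t`; it is `0` if the
arm has not been played (division by zero). -/
def avgReward {X : Type u} (x : ℕ → X) (y : ℕ → ℝ) (t : ℕ) (z : X) : ℝ :=
  (∑ s ∈ plays x t z, y s) / ((plays x t z).card : ℝ)

/-- Confidence radius `r_t(z)`. -/
def confRadius {X : Type u} (x : ℕ → X) (t : ℕ) (z : X) : ℝ :=
  Real.sqrt (8 * (phase t : ℝ) / (1 + ((plays x t z).card : ℝ)))

/-- Index `I_t(z)`. -/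
def index {X : Type u} (x : ℕ → X) (y : ℕ → ℝ) (t : ℕ) (z : X) : ℝ :=
  avgReward x y t z + 2 * confRadius x t z

/-- The arm `w` lies in the open confidence ball, at time `t`, of some arm of `A`. -/
def Covered {X : Type u} (D : X → X → ℝ≥0∞) (x : ℕ → X) (t : ℕ) (A : Set X) (w : X) : Prop :=
  ∃ z ∈ A, D z w < ENNReal.ofReal (confRadius x t z)

open Classical in
/-- The active arms at the start of round `t`, where `active s` are the active arms after the
activation step of round `s`; no arm is active at the start of a phase. -/
def activeBefore {X : Type u} (active : ℕ → Set X) (t : ℕ) : Set X :=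
  if t = phaseStart t then ∅ else active (t - 1)

/-- Activation rule: if some arm is not covered, one such arm is activated. -/
def ActivationRule {X : Type u} (D : X → X → ℝ≥0∞) (x : ℕ → X) (active : ℕ → Set X)
    (t : ℕ) : Prop :=
  ((∀ w, Covered D x t (activeBefore active t) w) ∧ active t = activeBefore active t) ∨
  (∃ w, ¬ Covered D x t (activeBefore active t) w ∧
    active t = insert w (activeBefore active t))

/-- Selection rule: an active arm of maximal index is played. -/
def SelectionRule {X : Type u} (x : ℕ → X) (y : ℕ → ℝ) (active : ℕ → Set X) (t : ℕ) : Prop :=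
  x t ∈ active t ∧ ∀ z ∈ active t, index x y t z ≤ index x y t (x t)

/-- The path `(x, y)` is an execution of the zooming algorithm, with arbitrary choices of the
uncovered arm and arbitrary tie-breaking. -/
def IsZoomingPath {X : Type u} (D : X → X → ℝ≥0∞) (x : ℕ → X) (y : ℕ → ℝ) : Prop :=
  ∃ active : ℕ → Set X, ∀ t, ActivationRule D x active t ∧ SelectionRule x y active t

/-! ### Stochastic rewards and regret -/

/-- Bandit feedback. `ℱ t` is the information available when the arm of round `t` has been chosen:
it contains the past arms and rewards and the current arm, whether the current arm repeats an
earlier one, and possibly internal randomness of the algorithm. Given `ℱ t`, the reward of round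
`t` has law `P (arm t)`. -/
structure IsBanditProcess {X : Type u} [MeasurableSpace X] (P : Kernel X ℝ)
    {Ω : Type v} [mΩ : MeasurableSpace Ω] (Pr : Measure Ω) (ℱ : Filtration ℕ mΩ)
    (arm : ℕ → Ω → X) (reward : ℕ → Ω → ℝ) : Prop where
  measurable_arm : ∀ t, Measurable[ℱ t] (arm t)
  measurable_repeat : ∀ s t, s ≤ t → MeasurableSet[ℱ t] {ω | arm s ω = arm t ω}
  measurable_reward : ∀ t, Measurable[ℱ (t + 1)] (reward t)
  reward_law : ∀ (t : ℕ) (A : Set Ω), MeasurableSet[ℱ t] A → ∀ B : Set ℝ, MeasurableSet B →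
    Pr (A ∩ reward t ⁻¹' B) = ∫⁻ ω in A, P (arm t ω) B ∂Pr

/-- The zooming algorithm run on the instance: bandit feedback in which every path is an execution
of the zooming algorithm. -/
structure IsZoomingProcess {X : Type u} [MeasurableSpace X] (D : X → X → ℝ≥0∞) (P : Kernel X ℝ)
    {Ω : Type v} [mΩ : MeasurableSpace Ω] (Pr : Measure Ω) (ℱ : Filtration ℕ mΩ)
    (arm : ℕ → Ω → X) (reward : ℕ → Ω → ℝ) : Prop extends
    IsBanditProcess P Pr ℱ arm reward where
  path : ∀ ω, IsZoomingPath D (fun t => arm t ω) (fun t => reward t ω)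

/-- Regret `R(t) = t * sup μ - E[μ(x_1) + ⋯ + μ(x_t)]` over the first `t` rounds. -/
def regret {X : Type u} (μ : X → ℝ) {Ω : Type v} [MeasurableSpace Ω] (Pr : Measure Ω)
    (arm : ℕ → Ω → X) (t : ℕ) : ℝ :=
  t * (⨆ x, μ x) - ∫ ω, ∑ s ∈ Finset.range t, μ (arm s ω) ∂Pr

end

end Zooming

namespace Zooming

/-! ### Concentration of the average rewards -/

/-! Concentration. Arms may be uncountable, so no union bound over arms is possible. An arm played
in phase i is instead named by the round s of its first play there; the later rounds repeating the
arm of s form a predictable selection. An exponential supermartingale and a union bound over triples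
(round, first play, number of plays) show that all averages of phase i are within their confidence
radii except with probability at most 2^(-i) (`IsBanditProcess.measure_not_accurate_le`).

Geometry. In such an accurate phase, some active arm covers a nearly optimal one or a fresh arm has
a huge index. Hence the played arm has Δ ≤ 3r (`badness_le_of_accurate`), so Δ²(1+n) ≤ 72i. The
later activated of two played arms was not covered by the earlier, so their distance is at least a
quarter of the earlier arm's Δ (`dist_of_ne`). At scale r each covering set thus contains at most
one played arm, which leaves at most 288·i·c·r^(-(d+2)) rounds at that scale.

Summation. An inaccurate phase obeys the same count with 2^i in place of 288i, since a nonempty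
scale forces c·r^(-d) ≥ 1; its expected extra cost is absorbed in 289i and stays proportional to c.
Peeling over dyadic scales bounds a phase of m rounds by m(A/m)^(1/(d+2)), with A proportional to
c·i (`IsZoomingProcess.integral_phase_le`). Jensen's inequality adds the phases while keeping every
constant inside the power 1/(d+2), so that C does not depend on d (`sum_phases_le`). -/

theorem measurable_meanPayoff {X : Type u} [MeasurableSpace X] (P : Kernel X ℝ)
    [IsMarkovKernel P] : Measurable (meanPayoff P) :=
  (StronglyMeasurable.integral_kernel_prod_right' (κ := P)
    (f := fun p : X × ℝ => p.2) measurable_snd.stronglyMeasurable).measurable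

theorem ae_mem_Icc {X : Type u} [MeasurableSpace X] {P : Kernel X ℝ} [IsMarkovKernel P]
    (hP : ∀ x, P x (Icc 0 1) = 1) (x : X) : ∀ᵐ y ∂(P x), y ∈ Icc (0 : ℝ) 1 :=
  (prob_compl_eq_zero_iff measurableSet_Icc).2 (hP x)

theorem meanPayoff_mem_Icc {X : Type u} [MeasurableSpace X] {P : Kernel X ℝ} [IsMarkovKernel P]
    (hP : ∀ x, P x (Icc 0 1) = 1) (x : X) : meanPayoff P x ∈ Icc (0 : ℝ) 1 := by
  have h := ae_mem_Icc hP x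
  refine ⟨integral_nonneg_of_ae (h.mono fun y hy => hy.1), ?_⟩
  have hi : Integrable (fun y : ℝ => y) (P x) :=
    Integrable.of_mem_Icc 0 1 measurable_id.aemeasurable h
  calc meanPayoff P x ≤ ∫ _, (1 : ℝ) ∂(P x) :=
        integral_mono_ae hi (integrable_const _) (h.mono fun y hy => hy.2)
    _ = 1 := by simp

/-- Hoeffding's lemma for the reward law of an arm. -/
theorem lintegral_exp_reward_le {X : Type u} [MeasurableSpace X] {P : Kernel X ℝ}
    [IsMarkovKernel P] (hP : ∀ x, P x (Icc 0 1) = 1) (x : X) (l : ℝ) :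
    ∫⁻ y, ENNReal.ofReal (Real.exp (l * (y - meanPayoff P x) - l ^ 2 / 8)) ∂(P x) ≤ 1 := by
  -- The variance proxy of a law on [0,1] is (1/2)² = 1/4, which gives l²/8 in the exponent.
  have h := hasSubgaussianMGF_of_mem_Icc (X := fun y : ℝ => y) (μ := P x)
    measurable_id.aemeasurable (ae_mem_Icc hP x)
  have hm := h.mgf_le l
  have hi : Integrable (fun y => Real.exp (l * (y - meanPayoff P x))) (P x) :=
    h.integrable_exp_mul l
  have e : ∀ y : ℝ, Real.exp (l * (y - meanPayoff P x) - l ^ 2 / 8)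
      = Real.exp (-(l ^ 2 / 8)) * Real.exp (l * (y - meanPayoff P x)) := fun y => by
    rw [← Real.exp_add]; ring_nf
  simp_rw [e]
  rw [← ofReal_integral_eq_lintegral_ofReal (hi.const_mul _)
    (ae_of_all _ fun y => by positivity), integral_const_mul]
  refine ENNReal.ofReal_le_one.2 ?_
  calc _ ≤ Real.exp (-(l ^ 2 / 8)) * Real.exp (l ^ 2 / 8) := by
        refine mul_le_mul_of_nonneg_left (hm.trans (le_of_eq ?_)) (Real.exp_pos _).le
        congr 1
        simp
        ring
    _ = 1 := by rw [← Real.exp_add]; simp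

/-- Integration against the joint law of the past and the next reward. -/
theorem lintegral_eq_of_conditional_law {X : Type u} [MeasurableSpace X] (P : Kernel X ℝ)
    [IsMarkovKernel P] {Ω Ω' : Type v} [MeasurableSpace Ω] [MeasurableSpace Ω'] (Pr : Measure Ω)
    [IsProbabilityMeasure Pr] {p : Ω → Ω'} (hp : Measurable p) {a : Ω' → X} (ha : Measurable a)
    {y : Ω → ℝ} (hy : Measurable y)
    (h : ∀ A : Set Ω', MeasurableSet A → ∀ B : Set ℝ, MeasurableSet B →
      Pr (p ⁻¹' A ∩ y ⁻¹' B) = ∫⁻ ω in p ⁻¹' A, P (a (p ω)) B ∂Pr)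
    {f : Ω' × ℝ → ℝ≥0∞} (hf : Measurable f) :
    ∫⁻ ω, f (p ω, y ω) ∂Pr = ∫⁻ ω, ∫⁻ z, f (p ω, z) ∂(P (a (p ω))) ∂Pr := by
  have hpy : Measurable fun ω => (p ω, y ω) := hp.prodMk hy
  have : IsProbabilityMeasure (Pr.map p) := Measure.isProbabilityMeasure_map hp.aemeasurable
  have : IsProbabilityMeasure (Pr.map fun ω => (p ω, y ω)) :=
    Measure.isProbabilityMeasure_map hpy.aemeasurable
  -- Rectangles determine a finite measure on the product, so the hypothesis identifies the joint
  -- law.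
  have key : Pr.map (fun ω => (p ω, y ω)) = (Pr.map p).compProd (P.comap a ha) := by
    refine Measure.ext_prod fun {A B} hA hB => ?_
    rw [Measure.map_apply hpy (hA.prod hB), Measure.compProd_apply_prod hA hB,
      setLIntegral_map hA (Kernel.measurable_coe _ hB) hp]
    exact h A hA B hB
  calc ∫⁻ ω, f (p ω, y ω) ∂Pr = ∫⁻ q, f q ∂(Pr.map fun ω => (p ω, y ω)) :=
        (lintegral_map hf hpy).symm
    _ = ∫⁻ ω', ∫⁻ z, f (ω', z) ∂(P.comap a ha ω') ∂(Pr.map p) := by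
        rw [key, Measure.lintegral_compProd hf]
    _ = _ := by
        rw [lintegral_map hf.lintegral_kernel_prod_right' hp]
        rfl

/-- The number of rounds before `t` selected by `A`. -/
noncomputable def selected {Ω : Type v} (A : ℕ → Set Ω) (t : ℕ) (ω : Ω) : ℝ :=
  ∑ s ∈ Finset.range t, (A s).indicator (fun _ => (1 : ℝ)) ω

theorem measurable_selected {Ω : Type v} [mΩ : MeasurableSpace Ω] {ℱ : Filtration ℕ mΩ}
    {A : ℕ → Set Ω} (hA : ∀ s, MeasurableSet[ℱ s] (A s)) (t : ℕ) :
    Measurable[ℱ t] (selected A t) := by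
  refine Finset.measurable_fun_sum _ fun s hs => ?_
  have hs : s < t := Finset.mem_range.1 hs
  exact Measurable.indicator measurable_const (ℱ.mono hs.le _ (hA s))

section Concentration

variable {X : Type u} [MeasurableSpace X] {P : Kernel X ℝ} [IsMarkovKernel P]
  {Ω : Type v} [mΩ : MeasurableSpace Ω] {Pr : Measure Ω}
  {ℱ : Filtration ℕ mΩ} {arm : ℕ → Ω → X} {reward : ℕ → Ω → ℝ}

/-- The sum, over the rounds before `t` selected by `A`, of the deviations of the rewards. -/
noncomputable def deviation (P : Kernel X ℝ) (arm : ℕ → Ω → X) (reward : ℕ → Ω → ℝ) (A : ℕ → Set Ω)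
    (t : ℕ) (ω : Ω) : ℝ :=
  ∑ s ∈ Finset.range t, (A s).indicator (fun ω => reward s ω - meanPayoff P (arm s ω)) ω

theorem IsBanditProcess.measurable_deviation (h : IsBanditProcess P Pr ℱ arm reward)
    {A : ℕ → Set Ω} (hA : ∀ s, MeasurableSet[ℱ s] (A s)) (t : ℕ) :
    Measurable[ℱ t] (deviation P arm reward A t) := by
  refine Finset.measurable_fun_sum _ fun s hs => ?_
  have hs : s < t := Finset.mem_range.1 hs
  refine Measurable.indicator (Measurable.sub ?_ ?_) (ℱ.mono hs.le _ (hA s))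
  · exact (h.measurable_reward s).mono (ℱ.mono hs) le_rfl
  · exact (measurable_meanPayoff P).comp ((h.measurable_arm s).mono (ℱ.mono hs.le) le_rfl)

variable [IsProbabilityMeasure Pr]

/-- The past is the identity map from Ω to Ω with the coarser σ-algebra `ℱ t`. -/
theorem IsBanditProcess.lintegral_eq (h : IsBanditProcess P Pr ℱ arm reward) (t : ℕ)
    {f : Ω × ℝ → ℝ≥0∞} (hf : Measurable[(ℱ t).prod inferInstance] f) :
    ∫⁻ ω, f (ω, reward t ω) ∂Pr = ∫⁻ ω, ∫⁻ z, f (ω, z) ∂(P (arm t ω)) ∂Pr :=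
  @lintegral_eq_of_conditional_law X _ P _ Ω Ω mΩ (ℱ t) Pr _ id
    (measurable_id'' (ℱ.le t)) (arm t) (h.measurable_arm t) (reward t)
    ((h.measurable_reward t).mono (ℱ.le _) le_rfl) (h.reward_law t) f hf

/-- The exponential supermartingale bound. -/
theorem IsBanditProcess.lintegral_exp_deviation_le (h : IsBanditProcess P Pr ℱ arm reward)
    (hP : ∀ x, P x (Icc 0 1) = 1) {A : ℕ → Set Ω} (hA : ∀ s, MeasurableSet[ℱ s] (A s))
    (l : ℝ) (t : ℕ) :
    ∫⁻ ω, ENNReal.ofReal (Real.exp (l * deviation P arm reward A t ω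
      - l ^ 2 / 8 * selected A t ω)) ∂Pr ≤ 1 := by
  induction t with
  | zero => simp [deviation, selected]
  | succ t ih =>
    let W : Ω → ℝ≥0∞ := fun ω => ENNReal.ofReal (Real.exp (l * deviation P arm reward A t ω
      - l ^ 2 / 8 * selected A t ω))
    let g : Ω × ℝ → ℝ := fun q => l * (A t).indicator (fun ω => q.2 - meanPayoff P (arm t ω)) q.1
      - l ^ 2 / 8 * (A t).indicator (fun _ => (1 : ℝ)) q.1
    have hW : Measurable[ℱ t] W := by
      have h1 := h.measurable_deviation hA t
      have h2 := measurable_selected (ℱ := ℱ) hA t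
      fun_prop
    have hg : Measurable[(ℱ t).prod inferInstance] g := by
      have h3 : Measurable[ℱ t] fun ω => meanPayoff P (arm t ω) :=
        (measurable_meanPayoff P).comp (h.measurable_arm t)
      have hset : MeasurableSet[(ℱ t).prod inferInstance] {q : Ω × ℝ | q.1 ∈ A t} :=
        @measurable_fst Ω ℝ (ℱ t) _ _ (hA t)
      have e : g = fun q => l * {q : Ω × ℝ | q.1 ∈ A t}.indicator
          (fun q => q.2 - meanPayoff P (arm t q.1)) q
          - l ^ 2 / 8 * {q : Ω × ℝ | q.1 ∈ A t}.indicator (fun _ => (1 : ℝ)) q := by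
        funext q
        by_cases hq : q.1 ∈ A t <;> simp [g, hq]
      rw [e]
      have h4 : Measurable[(ℱ t).prod inferInstance]
          fun q : Ω × ℝ => q.2 - meanPayoff P (arm t q.1) :=
        (@measurable_snd Ω ℝ (ℱ t) _).sub (h3.comp (@measurable_fst Ω ℝ (ℱ t) _))
      exact ((h4.indicator hset).const_mul _).sub ((measurable_const.indicator hset).const_mul _)
    have hf : Measurable[(ℱ t).prod inferInstance]
        fun q : Ω × ℝ => W q.1 * ENNReal.ofReal (Real.exp (g q)) :=
      (hW.comp (@measurable_fst Ω ℝ (ℱ t) _)).mul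
        (ENNReal.measurable_ofReal.comp (Real.measurable_exp.comp hg))
    calc _ = ∫⁻ ω, W ω * ENNReal.ofReal (Real.exp (g (ω, reward t ω))) ∂Pr := by
          refine lintegral_congr fun ω => ?_
          rw [← ENNReal.ofReal_mul (Real.exp_pos _).le, ← Real.exp_add]
          congr 2
          simp only [deviation, selected, Finset.sum_range_succ, g]
          by_cases hω : ω ∈ A t <;> simp [hω]
          ring
      _ = ∫⁻ ω, ∫⁻ z, W ω * ENNReal.ofReal (Real.exp (g (ω, z))) ∂(P (arm t ω)) ∂Pr :=
          h.lintegral_eq t hf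
      _ ≤ ∫⁻ ω, W ω ∂Pr := by
          refine lintegral_mono fun ω => ?_
          have hz : Measurable fun z => ENNReal.ofReal (Real.exp (g (ω, z))) := by
            by_cases hω : ω ∈ A t <;> simp only [g, hω, indicator_of_mem, indicator_of_notMem,
              not_false_eq_true] <;> fun_prop
          rw [lintegral_const_mul _ hz]
          refine mul_le_of_le_one_right' ?_
          by_cases hω : ω ∈ A t
          · simpa [g, hω] using lintegral_exp_reward_le hP (arm t ω) l
          · simp [g, hω]
      _ ≤ 1 := ih

/-- Hoeffding's inequality for a predictably selected set of `n` rounds. -/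
theorem IsBanditProcess.measure_deviation_le (h : IsBanditProcess P Pr ℱ arm reward)
    (hP : ∀ x, P x (Icc 0 1) = 1) {A : ℕ → Set Ω} (hA : ∀ s, MeasurableSet[ℱ s] (A s))
    (t : ℕ) (n r : ℝ) (hr : 0 ≤ r) :
    Pr {ω | selected A t ω = n ∧ n * r ≤ |deviation P arm reward A t ω|}
      ≤ ENNReal.ofReal (2 * Real.exp (-(2 * n * r ^ 2))) := by
  -- Both tails at once: l = ±4r is the optimal parameter, with exponent 4nr² - 2nr² = 2nr².
  have key : ∀ l : ℝ, l ^ 2 = 16 * r ^ 2 →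
      Pr {ω | selected A t ω = n ∧ n * (4 * r ^ 2) ≤ l * deviation P arm reward A t ω}
      ≤ ENNReal.ofReal (Real.exp (-(2 * n * r ^ 2))) := by
    intro l hl
    let Z : Ω → ℝ≥0∞ := fun ω => ENNReal.ofReal (Real.exp (l * deviation P arm reward A t ω
      - l ^ 2 / 8 * selected A t ω))
    have hZ : Measurable Z := by
      have h1 := (h.measurable_deviation hA t).mono (ℱ.le t) le_rfl
      have h2 := (measurable_selected (ℱ := ℱ) hA t).mono (ℱ.le t) le_rfl
      fun_prop
    have hpos : 0 < Real.exp (2 * n * r ^ 2) := Real.exp_pos _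
    have hmk := mul_meas_ge_le_lintegral (μ := Pr) hZ (ENNReal.ofReal (Real.exp (2 * n * r ^ 2)))
    have hle := hmk.trans (h.lintegral_exp_deviation_le hP hA l t)
    rw [Real.exp_neg, ENNReal.ofReal_inv_of_pos hpos]
    refine le_trans (measure_mono ?_) (ENNReal.le_inv_iff_mul_le.2 (by rwa [mul_comm]))
    rintro ω ⟨h1, h2⟩
    refine ENNReal.ofReal_le_ofReal (Real.exp_le_exp.2 ?_)
    rw [hl, h1]
    linarith
  calc _ ≤ Pr ({ω | selected A t ω = n ∧ n * (4 * r ^ 2) ≤ (4 * r) * deviation P arm reward A t ω}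
        ∪ {ω | selected A t ω = n ∧
          n * (4 * r ^ 2) ≤ (-(4 * r)) * deviation P arm reward A t ω}) := by
        refine measure_mono ?_
        rintro ω ⟨h1, h2⟩
        rcases le_abs.1 h2 with h3 | h3
        · exact Or.inl ⟨h1, by nlinarith⟩
        · exact Or.inr ⟨h1, by nlinarith⟩
    _ ≤ _ := (measure_union_le _ _).trans (add_le_add (key _ (by ring)) (key _ (by ring)))
    _ = _ := by
        rw [← ENNReal.ofReal_add (Real.exp_pos _).le (Real.exp_pos _).le, ← two_mul]

end Concentration

end Zooming

namespace Zooming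

/-! ### Executions of the algorithm with accurate averages -/

theorem one_le_phase (t : ℕ) : 1 ≤ phase t :=
  Nat.log_pos (by norm_num) (by omega)

theorem phaseStart_le (t : ℕ) : phaseStart t ≤ t := by
  have := Nat.pow_log_le_self 2 (x := t + 2) (by omega)
  unfold phaseStart phase
  omega

theorem phase_mono {s t : ℕ} (h : s ≤ t) : phase s ≤ phase t :=
  Nat.log_mono_right (by omega)

theorem phase_eq_of_phaseStart_le {s t : ℕ} (h : phaseStart t ≤ s) (hst : s ≤ t) :
    phase s = phase t := by
  refine le_antisymm (phase_mono hst) ?_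
  refine Nat.le_log_of_pow_le (by norm_num) ?_
  unfold phaseStart at h
  omega

theorem phaseStart_congr {s t : ℕ} (h : phase s = phase t) : phaseStart s = phaseStart t := by
  unfold phaseStart
  rw [h]

theorem phaseStart_le_of_phase_eq {s t : ℕ} (h : phase s = phase t) : phaseStart t ≤ s :=
  phaseStart_congr h ▸ phaseStart_le s

section Path

variable {X : Type u} {D : X → X → ℝ≥0∞} {μ : X → ℝ} {x : ℕ → X} {y : ℕ → ℝ}
  {active : ℕ → Set X}

theorem mem_plays {t s : ℕ} {z : X} : s ∈ plays x t z ↔ phaseStart t ≤ s ∧ s < t ∧ x s = z := by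
  simp [plays, and_assoc]

theorem activeBefore_subset {t : ℕ} (h : ActivationRule D x active t) :
    activeBefore active t ⊆ active t := by
  rcases h with ⟨_, h⟩ | ⟨w, _, h⟩
  · exact h.ge
  · exact h ▸ subset_insert _ _

theorem active_mono (h : ∀ t, ActivationRule D x active t) {s t : ℕ} (hs : phaseStart t ≤ s)
    (hst : s ≤ t) : active s ⊆ active t := by
  induction t, hst using Nat.le_induction with
  | base => exact Subset.rfl
  | succ t hst ih =>
    have hp : phase t = phase (t + 1) := phase_eq_of_phaseStart_le (by omega) (by omega)
    have hne : t + 1 ≠ phaseStart (t + 1) := by omega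
    have h1 : activeBefore active (t + 1) = active t := by
      rw [activeBefore, if_neg hne, Nat.add_sub_cancel]
    exact (ih (phaseStart_congr hp ▸ hs)).trans (h1 ▸ activeBefore_subset (h (t + 1)))

theorem active_subset_activeBefore (h : ∀ t, ActivationRule D x active t) {s t : ℕ}
    (hs : phaseStart t ≤ s) (hst : s < t) : active s ⊆ activeBefore active t := by
  have hp : phase (t - 1) = phase t := phase_eq_of_phaseStart_le (by omega) (by omega)
  rw [activeBefore, if_neg (by omega)]
  exact active_mono h (phaseStart_congr hp ▸ hs) (by omega)

/-- Active sets are emptied at each phase start and otherwise grow only by activations, so one can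
go back to the round at which z entered. -/
theorem exists_activation (h : ∀ t, ActivationRule D x active t) {z : X} {t : ℕ}
    (hz : z ∈ active t) : ∃ s, phaseStart t ≤ s ∧ s ≤ t ∧ active s = insert z (activeBefore active s)
      ∧ ¬ Covered D x s (activeBefore active s) z := by
  induction t with
  | zero =>
    have he : activeBefore active 0 = ∅ := if_pos (Nat.le_zero.1 (phaseStart_le 0)).symm
    rcases h 0 with ⟨_, h0⟩ | ⟨w, hw, h0⟩
    · rw [h0, he] at hz
      exact hz.elim
    · have hzw : z = w := by
        rw [h0, he] at hz
        simpa using hz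
      exact ⟨0, phaseStart_le 0, le_rfl, hzw ▸ h0, hzw ▸ hw⟩
  | succ t ih =>
    have hb : z ∈ activeBefore active (t + 1) → ∃ s, phaseStart (t + 1) ≤ s ∧ s ≤ t + 1 ∧
        active s = insert z (activeBefore active s) ∧
        ¬ Covered D x s (activeBefore active s) z := by
      intro hz
      by_cases hs : t + 1 = phaseStart (t + 1)
      · rw [activeBefore, if_pos hs] at hz
        exact hz.elim
      · rw [activeBefore, if_neg hs, Nat.add_sub_cancel] at hz
        obtain ⟨s, h1, h2, h3⟩ := ih hz
        have hp : phase t = phase (t + 1) :=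
          phase_eq_of_phaseStart_le (by have := phaseStart_le (t + 1); omega) (by omega)
        exact ⟨s, phaseStart_congr hp ▸ h1, by omega, h3⟩
    rcases h (t + 1) with ⟨_, h0⟩ | ⟨w, hw, h0⟩
    · exact hb (h0 ▸ hz)
    · rw [h0] at hz
      rcases hz with rfl | hz
      · exact ⟨t + 1, phaseStart_le _, le_rfl, h0, hw⟩
      · exact hb hz

/-- The averages of all arms played so far in the phase are within the confidence radius. -/
def Accurate (μ : X → ℝ) (x : ℕ → X) (y : ℕ → ℝ) (t : ℕ) : Prop :=
  ∀ s, phaseStart t ≤ s → s < t →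
    |avgReward x y t (x s) - μ (x s)| ≤ confRadius x t (x s)

theorem confRadius_sq (t : ℕ) (z : X) :
    confRadius x t z ^ 2 = 8 * (phase t : ℝ) / (1 + ((plays x t z).card : ℝ)) :=
  Real.sq_sqrt (by positivity)

theorem confRadius_nonneg (t : ℕ) (z : X) : 0 ≤ confRadius x t z := Real.sqrt_nonneg _

/-- The radius is √(8i) ≥ √8 > 14/5. This exceeds the reward range by enough to make all bounds for
fresh arms trivial. -/
theorem le_confRadius_of_plays_eq_empty {t : ℕ} {z : X} (h : plays x t z = ∅) :
    (14 : ℝ) / 5 ≤ confRadius x t z := by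
  refine Real.le_sqrt_of_sq_le ?_
  have h1 : (1 : ℝ) ≤ phase t := by exact_mod_cast one_le_phase t
  rw [h]
  simp only [Finset.card_empty, Nat.cast_zero]
  linarith

/-- For an unplayed arm the default average 0 is within 1 of the mean, and the radius exceeds 1. -/
theorem Accurate.abs_sub_le {t : ℕ} (h : Accurate μ x y t) (hμ : ∀ z, μ z ∈ Icc (0 : ℝ) 1)
    (z : X) : |avgReward x y t z - μ z| ≤ confRadius x t z := by
  rcases (plays x t z).eq_empty_or_nonempty with h0 | ⟨s, hs⟩
  · have h1 := le_confRadius_of_plays_eq_empty h0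
    have := hμ z
    rw [avgReward, h0]
    simp only [Finset.sum_empty, Finset.card_empty, Nat.cast_zero, div_zero, zero_sub, abs_neg]
    rw [abs_of_nonneg this.1]
    linarith [this.2]
  · obtain ⟨h1, h2, rfl⟩ := mem_plays.1 hs
    exact h s h1 h2

theorem bddAbove_of_mem_Icc (hμ : ∀ z, μ z ∈ Icc (0 : ℝ) 1) : BddAbove (range μ) :=
  ⟨1, by rintro _ ⟨z, rfl⟩; exact (hμ z).2⟩

theorem badness_nonneg (hμ : ∀ z, μ z ∈ Icc (0 : ℝ) 1) (z : X) : 0 ≤ badness μ z :=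
  sub_nonneg.2 (le_ciSup (bddAbove_of_mem_Icc hμ) z)

theorem badness_le_one (hμ : ∀ z, μ z ∈ Icc (0 : ℝ) 1) (z : X) : badness μ z ≤ 1 := by
  have : Nonempty X := ⟨z⟩
  have h1 : ⨆ z, μ z ≤ 1 := ciSup_le fun w => (hμ w).2
  have h2 := (hμ z).1
  unfold badness
  linarith

/-- An arm played earlier in the phase is active and covers itself, its radius being positive. -/
theorem plays_eq_empty_of_not_covered (hD : ∀ z, D z z = 0)
    (h : ∀ t, ActivationRule D x active t ∧ SelectionRule x y active t) {t : ℕ} {w : X}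
    (hw : ¬ Covered D x t (activeBefore active t) w) : plays x t w = ∅ := by
  by_contra hne
  obtain ⟨s, hs⟩ := Finset.nonempty_iff_ne_empty.2 hne
  obtain ⟨h1, h2, rfl⟩ := mem_plays.1 hs
  refine hw ⟨x s, active_subset_activeBefore (fun t => (h t).1) h1 h2 (h s).2.1, ?_⟩
  rw [hD]
  refine ENNReal.ofReal_pos.2 (Real.sqrt_pos.2 ?_)
  have := one_le_phase t
  positivity

/-- The badness of the arm that is played is at most three times its confidence radius. -/
theorem badness_le_of_accurate (hD : ∀ z, D z z = 0) (hμ : ∀ z, μ z ∈ Icc (0 : ℝ) 1)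
    (hL : RelaxedLipschitz D μ)
    (h : ∀ t, ActivationRule D x active t ∧ SelectionRule x y active t) {t : ℕ}
    (ht : Accurate μ x y t) : badness μ (x t) ≤ 3 * confRadius x t (x t) := by
  have hx := abs_le.1 (ht.abs_sub_le hμ (x t))
  have hsel := (h t).2.2
  rcases (h t).1 with ⟨hcov, hact⟩ | ⟨w, hw, hact⟩
  -- The arm z covering xs has index at least μ(z) + r(z) ≥ μ* - ε, while the played arm has index
  -- at most μ + 3r.
  · refine le_of_forall_pos_le_add fun ε hε => ?_
    obtain ⟨xs, hxs⟩ := hL ε hε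
    obtain ⟨z, hz, hzx⟩ := hcov xs
    have h1 : badness μ z ≤ confRadius x t z + ε := by
      have h2 := (hxs z).trans (add_le_add_left hzx.le (ENNReal.ofReal ε))
      rw [← ENNReal.ofReal_add (confRadius_nonneg t z) hε.le] at h2
      exact (ENNReal.ofReal_le_ofReal_iff (add_nonneg (confRadius_nonneg t z) hε.le)).1 h2
    have h3 := hsel z (hact ▸ hz)
    have h4 := abs_le.1 (ht.abs_sub_le hμ z)
    unfold index at h3
    unfold badness at h1 ⊢
    linarith [h4.1, hx.2]
  -- The fresh arm w has index at least 14/5, so 3r ≥ 14/5 - 1 ≥ 1 for the played arm.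
  · have h0 := plays_eq_empty_of_not_covered hD h hw
    have h1 := le_confRadius_of_plays_eq_empty h0
    have h3 := hsel w (hact ▸ mem_insert _ _)
    have h4 := abs_le.1 (ht.abs_sub_le hμ w)
    unfold index at h3
    linarith [h4.1, hx.2, (hμ w).1, (hμ (x t)).2, badness_le_one hμ (x t)]

/-- The number of plays of an arm is bounded in terms of its badness. -/
theorem badness_sq_mul_le (hD : ∀ z, D z z = 0) (hμ : ∀ z, μ z ∈ Icc (0 : ℝ) 1)
    (hL : RelaxedLipschitz D μ)
    (h : ∀ t, ActivationRule D x active t ∧ SelectionRule x y active t) {t : ℕ}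
    (ht : Accurate μ x y t) :
    badness μ (x t) ^ 2 * (1 + ((plays x t (x t)).card : ℝ)) ≤ 72 * phase t := by
  have h1 := badness_le_of_accurate hD hμ hL h ht
  have h2 := confRadius_sq (x := x) t (x t)
  have hn : 0 < 1 + ((plays x t (x t)).card : ℝ) := by positivity
  have h3 : badness μ (x t) ^ 2 ≤ 9 * confRadius x t (x t) ^ 2 := by
    nlinarith [badness_nonneg hμ (x t)]
  rw [h2, ← mul_div_assoc, le_div_iff₀ hn] at h3
  linarith

theorem card_plays_eq {s t : ℕ} {z : X} (hs : s ∈ plays x t z)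
    (hmax : ∀ s' ∈ plays x t z, s' ≤ s) : (plays x t z).card = (plays x s z).card + 1 := by
  obtain ⟨h1, h2, h3⟩ := mem_plays.1 hs
  have hp := phaseStart_congr (phase_eq_of_phaseStart_le h1 h2.le)
  have e : plays x t z = insert s (plays x s z) := by
    ext v
    rw [Finset.mem_insert]
    constructor
    · intro hv
      rcases (hmax v hv).lt_or_eq with h4 | h4
      · obtain ⟨h5, -, h6⟩ := mem_plays.1 hv
        exact Or.inr (mem_plays.2 ⟨hp ▸ h5, h4, h6⟩)
      · exact Or.inl h4
    · rintro (rfl | hv)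
      · exact hs
      · obtain ⟨h5, h6, h7⟩ := mem_plays.1 hv
        exact mem_plays.2 ⟨hp ▸ h5, h6.trans h2, h7⟩
  rw [e, Finset.card_insert_of_notMem]
  exact fun hs' => (mem_plays.1 hs').2.1.false

/-- At any time of an accurate phase, the badness of an arm is at most four times its
confidence radius. -/
theorem badness_le_four_mul (hD : ∀ z, D z z = 0) (hμ : ∀ z, μ z ∈ Icc (0 : ℝ) 1)
    (hL : RelaxedLipschitz D μ)
    (h : ∀ t, ActivationRule D x active t ∧ SelectionRule x y active t) {t : ℕ}
    (ht : ∀ s, phase s = phase t → Accurate μ x y s) (z : X) :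
    badness μ z ≤ 4 * confRadius x t z := by
  have hz0 := badness_nonneg hμ z
  have hz1 := badness_le_one hμ z
  rcases (plays x t z).eq_empty_or_nonempty with h0 | hne
  · linarith [le_confRadius_of_plays_eq_empty h0]
  · obtain ⟨s, hs, hmax⟩ : ∃ s ∈ plays x t z, ∀ s' ∈ plays x t z, s' ≤ s :=
      ⟨_, Finset.max'_mem _ hne, fun s' hs' => Finset.le_max' _ s' hs'⟩
    have hcard := card_plays_eq hs hmax
    obtain ⟨h1, h2, rfl⟩ := mem_plays.1 hs
    have hp := phase_eq_of_phaseStart_le h1 h2.le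
    -- The bound holds at the last play s; one more play costs Δ² ≤ 1, and 72i + 1 ≤ 128i = 16·8i.
    have h3 := badness_sq_mul_le hD hμ hL h (ht s hp)
    rw [hp] at h3
    refine (pow_le_pow_iff_left₀ hz0
      (by linarith [confRadius_nonneg (x := x) t (x s)]) two_ne_zero).1 ?_
    rw [mul_pow, confRadius_sq, hcard]
    push_cast
    have hi : (1 : ℝ) ≤ phase t := by exact_mod_cast one_le_phase t
    have hsq : badness μ (x s) ^ 2 ≤ 1 := pow_le_one₀ hz0 hz1
    have hn : (0 : ℝ) < 1 + (((plays x s (x s)).card : ℝ) + 1) := by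
      linarith [Nat.cast_nonneg (α := ℝ) (plays x s (x s)).card]
    rw [← mul_div_assoc, le_div_iff₀ hn]
    linarith

/-- Distinct arms played in an accurate phase are far apart. -/
theorem dist_of_ne (hD : ∀ z, D z z = 0) (hμ : ∀ z, μ z ∈ Icc (0 : ℝ) 1)
    (hL : RelaxedLipschitz D μ)
    (h : ∀ t, ActivationRule D x active t ∧ SelectionRule x y active t) {s t : ℕ}
    (hp : phase s = phase t) (ht : ∀ s, phase s = phase t → Accurate μ x y s)
    (hne : x s ≠ x t) :
    ENNReal.ofReal (badness μ (x s) / 4) ≤ D (x s) (x t) ∨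
      ENNReal.ofReal (badness μ (x t) / 4) ≤ D (x t) (x s) := by
  have hact : ∀ t, ActivationRule D x active t := fun t => (h t).1
  have key : ∀ a b : ℕ, phase b = phase t → phaseStart b ≤ a → a < b → ∀ z w,
      z ∈ active a → ¬ Covered D x b (activeBefore active b) w →
      ENNReal.ofReal (badness μ z / 4) ≤ D z w := by
    intro a b hb hab1 hab z w hz hw
    refine le_of_not_gt fun hlt => hw ⟨z, active_subset_activeBefore hact hab1 hab hz, ?_⟩
    refine hlt.trans_le (ENNReal.ofReal_le_ofReal ?_)
    linarith [badness_le_four_mul hD hμ hL h (t := b) (fun s hs => ht s (hs.trans hb)) z]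
  obtain ⟨a, ha1, ha2, ha3, ha4⟩ := exists_activation hact (h s).2.1
  obtain ⟨b, hb1, hb2, hb3, hb4⟩ := exists_activation hact (h t).2.1
  have hpa : phase a = phase t := (phase_eq_of_phaseStart_le ha1 ha2).trans hp
  have hpb : phase b = phase t := phase_eq_of_phaseStart_le hb1 hb2
  rcases lt_trichotomy a b with hab | rfl | hab
  · exact Or.inl (key a b hpb (phaseStart_le_of_phase_eq (hpa.trans hpb.symm)) hab _ _
      (ha3 ▸ mem_insert _ _) hb4)
  -- A round activates only one arm, and an uncovered arm cannot already be active.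
  · exfalso
    have hmem : ∀ z, ¬ Covered D x a (activeBefore active a) z → z ∉ activeBefore active a := by
      intro z hz hz'
      refine hz ⟨z, hz', ?_⟩
      rw [hD]
      refine ENNReal.ofReal_pos.2 (Real.sqrt_pos.2 ?_)
      have := one_le_phase a
      positivity
    have h1 : x s ∈ insert (x t) (activeBefore active a) := hb3 ▸ ha3 ▸ mem_insert _ _
    rcases h1 with h1 | h1
    · exact hne h1
    · exact hmem _ ha4 h1
  · exact Or.inr (key b a hpa (phaseStart_le_of_phase_eq (hpb.trans hpa.symm)) hab _ _
      (hb3 ▸ mem_insert _ _) ha4)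

open Classical in
/-- In an accurate phase, each set of small diameter accounts for few near-optimal rounds. -/
theorem card_rounds_le (hD : ∀ z, D z z = 0) (hμ : ∀ z, μ z ∈ Icc (0 : ℝ) 1)
    (hL : RelaxedLipschitz D μ) (hpath : IsZoomingPath D x y) {i : ℕ}
    (hi : ∀ s, phase s = i → Accurate μ x y s) {r : ℝ} (hr : 0 < r) {F : Finset (Set X)}
    (hF : ∀ S ∈ F, diam D S < ENNReal.ofReal (r / 8)) (hcov : nearOptimal μ r ⊆ ⋃ S ∈ F, S)
    {U : Finset ℕ} (hU : ∀ s ∈ U, phase s = i) :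
    ((U.filter fun s => x s ∈ nearOptimal μ r).card : ℝ) ≤ F.card * (288 * i / r ^ 2) := by
  obtain ⟨active, h⟩ := hpath
  set V := U.filter fun s => x s ∈ nearOptimal μ r with hV
  have hcov' : ∀ s ∈ V, ∃ S ∈ F, x s ∈ S := fun s hs => by
    simpa using hcov (Finset.mem_filter.1 hs).2
  choose! f hf1 hf2 using hcov'
  -- Distinct played arms at this scale are at distance at least Δ/4 > r/8 in some order, too far
  -- for one covering set.
  have hsame : ∀ s ∈ V, ∀ t ∈ V, f s = f t → x s = x t := by
    intro s hs t ht hst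
    by_contra hne
    have hs' := Finset.mem_filter.1 hs
    have ht' := Finset.mem_filter.1 ht
    have hdi := hF _ (hf1 s hs)
    have hle : ∀ z ∈ f s, ∀ w ∈ f s, D z w < ENNReal.ofReal (r / 8) := fun z hz w hw =>
      lt_of_le_of_lt (le_iSup₂_of_le (f := fun z _ => ⨆ w ∈ f s, D z w) z hz
        (le_iSup₂_of_le (f := fun w _ => D z w) w hw le_rfl)) hdi
    have hbig : ∀ z ∈ nearOptimal μ r,
        ENNReal.ofReal (r / 8) ≤ ENNReal.ofReal (badness μ z / 4) := fun z hz =>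
      ENNReal.ofReal_le_ofReal (by linarith [hz.1])
    rcases dist_of_ne hD hμ hL h ((hU s hs'.1).trans (hU t ht'.1).symm)
      (fun v hv => hi v (hv.trans (hU t ht'.1))) hne with h1 | h1
    · exact absurd (hle _ (hf2 s hs) _ (hst ▸ hf2 t ht)) (not_lt.2 ((hbig _ hs'.2).trans h1))
    · exact absurd (hle _ (hst ▸ hf2 t ht) _ (hf2 s hs)) (not_lt.2 ((hbig _ ht'.2).trans h1))
  have hfib : ∀ S ∈ F, ((V.filter fun s => f s = S).card : ℝ) ≤ 288 * i / r ^ 2 := by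
    intro S _
    rcases (V.filter fun s => f s = S).eq_empty_or_nonempty with h0 | hne
    · rw [h0]
      simp only [Finset.card_empty, Nat.cast_zero]
      positivity
    · obtain ⟨t, ht, hmax⟩ : ∃ t ∈ V.filter fun s => f s = S,
          ∀ s ∈ V.filter fun s => f s = S, s ≤ t :=
        ⟨_, Finset.max'_mem _ hne, fun s' hs' => Finset.le_max' _ s' hs'⟩
      obtain ⟨htV, htS⟩ := Finset.mem_filter.1 ht
      have ht' := Finset.mem_filter.1 htV
      have hpt := hU t ht'.1
      -- All rounds of the fibre play the arm of its last round t, so the play bound at t controls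
      -- them.
      have hsub : (V.filter fun s => f s = S) ⊆ insert t (plays x t (x t)) := by
        intro s hs
        obtain ⟨hsV, hsS⟩ := Finset.mem_filter.1 hs
        rcases (hmax s hs).lt_or_eq with h4 | h4
        · refine Finset.mem_insert_of_mem (mem_plays.2 ⟨?_, h4, ?_⟩)
          · exact phaseStart_le_of_phase_eq ((hU s (Finset.mem_filter.1 hsV).1).trans hpt.symm)
          · exact hsame s hsV t htV (hsS.trans htS.symm)
        · exact h4 ▸ Finset.mem_insert_self _ _
      have h1 : ((V.filter fun s => f s = S).card : ℝ) ≤ 1 + ((plays x t (x t)).card : ℝ) := by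
        have := (Finset.card_le_card hsub).trans (Finset.card_insert_le _ _)
        have h2 : ((V.filter fun s => f s = S).card : ℝ) ≤ (plays x t (x t)).card + 1 := by
          exact_mod_cast this
        linarith
      have h2 := badness_sq_mul_le hD hμ hL h (hi t hpt)
      rw [hpt] at h2
      rw [le_div_iff₀ (by positivity)]
      have h3 : r ^ 2 ≤ 4 * badness μ (x t) ^ 2 := by nlinarith [ht'.2.1]
      nlinarith [Nat.cast_nonneg (α := ℝ) (V.filter fun s => f s = S).card,
        sq_nonneg (badness μ (x t))]
  rw [Finset.card_eq_sum_card_fiberwise (f := f) (t := F) (fun s hs => hf1 s hs)]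
  push_cast
  refine (Finset.sum_le_sum hfib).trans (le_of_eq ?_)
  rw [Finset.sum_const, nsmul_eq_mul]

end Path

end Zooming

namespace Zooming

/-! ### Accurate phases are likely -/

theorem two_pow_le_of_phase_eq {t i : ℕ} (h : phase t = i) : 2 ^ i ≤ t + 2 :=
  h ▸ Nat.pow_log_le_self 2 (by omega)

theorem lt_two_pow_of_phase_eq {t i : ℕ} (h : phase t = i) : t + 2 < 2 ^ (i + 1) :=
  h ▸ Nat.lt_pow_succ_log_self (by norm_num) _

/-- The rounds of phase `i`. -/
def phaseRounds (i : ℕ) : Finset ℕ := Finset.Ico (2 ^ i - 2) (2 ^ (i + 1) - 2)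

theorem mem_phaseRounds_of_phase_eq {t i : ℕ} (h : phase t = i) : t ∈ phaseRounds i := by
  have h1 := two_pow_le_of_phase_eq h
  have h2 := lt_two_pow_of_phase_eq h
  rw [phaseRounds, Finset.mem_Ico]
  omega

theorem card_phaseRounds_le (i : ℕ) : (phaseRounds i).card ≤ 2 ^ i := by
  rw [phaseRounds, Nat.card_Ico, pow_succ]
  omega

theorem card_plays_le {X : Type u} (x : ℕ → X) (t : ℕ) (z : X) :
    (plays x t z).card ≤ 2 ^ phase t := by
  refine le_trans (Finset.card_le_card fun s hs => ?_) (card_phaseRounds_le (phase t))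
  obtain ⟨h1, h2, -⟩ := mem_plays.1 hs
  exact mem_phaseRounds_of_phase_eq (phase_eq_of_phaseStart_le h1 h2.le)

/-- The event that round `v` repeats the arm of the earlier or current round `s`. -/
def repeats {X : Type u} {Ω : Type v} (arm : ℕ → Ω → X) (s v : ℕ) : Set Ω := {ω | s ≤ v ∧ arm s ω = arm v ω}

/-- Starting from the first play s in the phase excludes plays in earlier phases, so a sum over a
random arm's plays becomes one indexed by s. -/
theorem sum_indicator_repeats {X : Type u} {Ω : Type v} {arm : ℕ → Ω → X} {t s : ℕ} {ω : Ω}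
    (hs : s ∈ plays (fun t => arm t ω) t (arm s ω))
    (hmin : ∀ v ∈ plays (fun t => arm t ω) t (arm s ω), s ≤ v) (f : ℕ → Ω → ℝ) :
    ∑ v ∈ Finset.range t, (repeats arm s v).indicator (f v) ω
      = ∑ v ∈ plays (fun t => arm t ω) t (arm s ω), f v ω := by
  classical
  have e : plays (fun t => arm t ω) t (arm s ω)
      = (Finset.range t).filter fun v => ω ∈ repeats arm s v := by
    ext v
    rw [Finset.mem_filter, Finset.mem_range]
    constructor
    · intro hv
      obtain ⟨h1, h2, h3⟩ := mem_plays.1 hv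
      exact ⟨h2, hmin v hv, h3.symm⟩
    · rintro ⟨h1, h2, h3⟩
      exact mem_plays.2 ⟨(mem_plays.1 hs).1.trans h2, h1, h3.symm⟩
  rw [e, Finset.sum_filter]
  rfl

/-- An inaccurate average is a large deviation of a selected set of rounds. -/
theorem exists_deviation_of_not_accurate {X : Type u} [MeasurableSpace X] {P : Kernel X ℝ}
    {Ω : Type v} {arm : ℕ → Ω → X} {reward : ℕ → Ω → ℝ} {t : ℕ} {ω : Ω}
    (hω : ¬ Accurate (meanPayoff P) (fun t => arm t ω) (fun t => reward t ω) t) :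
    ∃ s, phase s = phase t ∧ ∃ n : ℕ, 1 ≤ n ∧ n ≤ 2 ^ phase t ∧
      selected (repeats arm s) t ω = n ∧
      n * Real.sqrt (8 * (phase t : ℝ) / (1 + (n : ℝ)))
        ≤ |deviation P arm reward (repeats arm s) t ω| := by
  unfold Accurate at hω
  push Not at hω
  obtain ⟨s', h1, h2, h3⟩ := hω
  have hne : (plays (fun t => arm t ω) t (arm s' ω)).Nonempty := ⟨s', mem_plays.2 ⟨h1, h2, rfl⟩⟩
  obtain ⟨s, hs, hmin⟩ : ∃ s ∈ plays (fun t => arm t ω) t (arm s' ω),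
      ∀ v ∈ plays (fun t => arm t ω) t (arm s' ω), s ≤ v :=
    ⟨_, Finset.min'_mem _ hne, fun v hv => Finset.min'_le _ v hv⟩
  obtain ⟨h4, h5, h6⟩ := mem_plays.1 hs
  have h6 : arm s ω = arm s' ω := h6
  simp only [← h6] at h3 hs hmin hne
  refine ⟨s, phase_eq_of_phaseStart_le h4 h5.le, (plays (fun t => arm t ω) t (arm s ω)).card,
    hne.card_pos, card_plays_le _ _ _, ?_, ?_⟩
  · rw [selected, sum_indicator_repeats hs hmin]
    simp
  · have hn : (0 : ℝ) < (plays (fun t => arm t ω) t (arm s ω)).card := by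
      exact_mod_cast hne.card_pos
    have e : deviation P arm reward (repeats arm s) t ω
        = (plays (fun t => arm t ω) t (arm s ω)).card *
          (avgReward (fun t => arm t ω) (fun t => reward t ω) t (arm s ω)
            - meanPayoff P (arm s ω)) := by
      rw [deviation, sum_indicator_repeats hs hmin, Finset.sum_sub_distrib, avgReward, mul_sub,
        mul_div_cancel₀ _ hn.ne']
      congr 1
      rw [← nsmul_eq_mul, ← Finset.sum_const]
      refine Finset.sum_congr rfl fun v hv => ?_
      rw [show arm v ω = arm s ω from (mem_plays.1 hv).2.2]
    rw [e, abs_mul, abs_of_pos hn]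
    exact mul_le_mul_of_nonneg_left h3.le hn.le

theorem exp_neg_eight_mul_le (i : ℕ) : Real.exp (-(8 * i : ℝ)) ≤ (1 / 256) ^ i := by
  have h1 : (256 : ℝ) ≤ Real.exp 8 := by
    have h2 : (2 : ℝ) ≤ Real.exp 1 := by linarith [Real.add_one_le_exp (1 : ℝ)]
    calc (256 : ℝ) = 2 ^ 8 := by norm_num
      _ ≤ Real.exp 1 ^ 8 := pow_le_pow_left₀ (by norm_num) h2 8
      _ = Real.exp 8 := by rw [← Real.exp_nat_mul]; norm_num
  rw [mul_comm, ← mul_neg, Real.exp_nat_mul, Real.exp_neg]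
  refine pow_le_pow_left₀ (by positivity) ?_ i
  rw [one_div]
  exact inv_anti₀ (by norm_num) h1

section Concentration

variable {X : Type u} [MeasurableSpace X] {P : Kernel X ℝ}
  {Ω : Type v} [mΩ : MeasurableSpace Ω] {Pr : Measure Ω}
  {ℱ : Filtration ℕ mΩ} {arm : ℕ → Ω → X} {reward : ℕ → Ω → ℝ}

theorem IsBanditProcess.measurableSet_repeats (h : IsBanditProcess P Pr ℱ arm reward)
    (s v : ℕ) : MeasurableSet[ℱ v] (repeats arm s v) := by
  by_cases hsv : s ≤ v
  · simpa [repeats, hsv] using h.measurable_repeat s v hsv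
  · simp [repeats, hsv]

variable [IsMarkovKernel P] [IsProbabilityMeasure Pr]

/-- There are at most 8^i triples (t, s, n), each of probability at most 2·256^(-i). -/
theorem IsBanditProcess.measure_not_accurate_le (h : IsBanditProcess P Pr ℱ arm reward)
    (hP : ∀ x, P x (Icc 0 1) = 1) {i : ℕ} (hi : 1 ≤ i) :
    Pr {ω | ∃ t, phase t = i ∧
      ¬ Accurate (meanPayoff P) (fun t => arm t ω) (fun t => reward t ω) t}
      ≤ ENNReal.ofReal (1 / 2 ^ i) := by
  let E : ℕ → ℕ → ℕ → Set Ω := fun t s n => {ω | selected (repeats arm s) t ω = n ∧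
      n * Real.sqrt (8 * (i : ℝ) / (1 + (n : ℝ)))
        ≤ |deviation P arm reward (repeats arm s) t ω|}
  have hE : ∀ t s, ∀ n ∈ Finset.Icc 1 (2 ^ i),
      Pr (E t s n) ≤ ENNReal.ofReal (2 * (1 / 256) ^ i) := by
    intro t s n hn
    refine (h.measure_deviation_le hP (h.measurableSet_repeats s) t n _
      (Real.sqrt_nonneg _)).trans (ENNReal.ofReal_le_ofReal ?_)
    refine mul_le_mul_of_nonneg_left (le_trans (Real.exp_le_exp.2 (neg_le_neg ?_))
      (exp_neg_eight_mul_le i)) (by norm_num)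
    -- n ≥ 1 gives 2n·8i/(1+n) ≥ 8i.
    have hn1 : (1 : ℝ) ≤ n := by exact_mod_cast (Finset.mem_Icc.1 hn).1
    rw [Real.sq_sqrt (by positivity), ← mul_div_assoc, le_div_iff₀ (by positivity)]
    nlinarith [Nat.cast_nonneg (α := ℝ) i]
  have hsub : {ω | ∃ t, phase t = i ∧
      ¬ Accurate (meanPayoff P) (fun t => arm t ω) (fun t => reward t ω) t}
      ⊆ ⋃ t ∈ phaseRounds i, ⋃ s ∈ phaseRounds i, ⋃ n ∈ Finset.Icc 1 (2 ^ i), E t s n := by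
    rintro ω ⟨t, rfl, hω⟩
    obtain ⟨s, hs, n, hn1, hn2, hn3⟩ := exists_deviation_of_not_accurate hω
    simp only [mem_iUnion]
    exact ⟨t, mem_phaseRounds_of_phase_eq rfl, s, mem_phaseRounds_of_phase_eq hs, n,
      Finset.mem_Icc.2 ⟨hn1, hn2⟩, hn3⟩
  have hcard : ((phaseRounds i).card : ℝ≥0∞) ≤ 2 ^ i := by exact_mod_cast card_phaseRounds_le i
  calc _ ≤ ∑ t ∈ phaseRounds i, ∑ s ∈ phaseRounds i, ∑ n ∈ Finset.Icc 1 (2 ^ i),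
        Pr (E t s n) := by
        refine (measure_mono hsub).trans ((measure_biUnion_finset_le _ _).trans ?_)
        refine Finset.sum_le_sum fun t _ => (measure_biUnion_finset_le _ _).trans ?_
        exact Finset.sum_le_sum fun s _ => measure_biUnion_finset_le _ _
    _ ≤ ∑ t ∈ phaseRounds i, ∑ s ∈ phaseRounds i, ∑ n ∈ Finset.Icc 1 (2 ^ i),
        ENNReal.ofReal (2 * (1 / 256) ^ i) :=
        Finset.sum_le_sum fun t _ => Finset.sum_le_sum fun s _ => Finset.sum_le_sum (hE t s)
    _ ≤ 2 ^ i * (2 ^ i * (2 ^ i * ENNReal.ofReal (2 * (1 / 256) ^ i))) := by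
        simp only [Finset.sum_const, nsmul_eq_mul, Nat.card_Icc, Nat.add_sub_cancel]
        push_cast
        gcongr
    _ = ENNReal.ofReal (2 ^ i * (2 ^ i * (2 ^ i * (2 * (1 / 256) ^ i)))) := by
        have e : (2 : ℝ≥0∞) ^ i = ENNReal.ofReal (2 ^ i) := by
          rw [ENNReal.ofReal_pow (by norm_num)]
          norm_num
        have hmul : ∀ q : ℝ, 2 ^ i * ENNReal.ofReal q = ENNReal.ofReal (2 ^ i * q) := fun q => by
          rw [e, ENNReal.ofReal_mul (by positivity)]
        rw [hmul, hmul, hmul]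
    _ ≤ _ := by
        refine ENNReal.ofReal_le_ofReal ?_
        have h1 : (2 : ℝ) ^ i * (2 ^ i * (2 ^ i * (2 * (1 / 256) ^ i)))
            = 2 * (1 / 16) ^ i * (1 / 2 ^ i) := by
          rw [← one_div_pow]
          have : (1 / 256 : ℝ) = 1 / 2 * (1 / 2) * (1 / 2) * (1 / 16) * (1 / 2) := by norm_num
          rw [this]
          simp only [mul_pow]
          have h2 : (2 : ℝ) ^ i * (1 / 2) ^ i = 1 := by rw [← mul_pow]; norm_num
          generalize (1 / 2 : ℝ) ^ i = p at *
          generalize (2 : ℝ) ^ i = q at *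
          calc _ = (q * p) * (q * p) * (q * p) * (2 * (1 / 16) ^ i * p) := by ring
            _ = _ := by rw [h2]; ring
        rw [h1]
        refine mul_le_of_le_one_left (by positivity) ?_
        have h3 : (1 / 16 : ℝ) ^ i ≤ (1 / 16) ^ 1 :=
          pow_le_pow_of_le_one (by norm_num) (by norm_num) hi
        linarith

end Concentration

end Zooming

namespace Zooming

/-! ### Summation over scales and over phases -/

section Scales

variable {ι : Type*} {U : Finset ι} {g : ι → ℝ} {K a : ℝ}

open Classical in
-- Scale r contributes at most K·r^(1-a), a series decaying at least geometrically with ratio 1/2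
-- along r = 2δ, 4δ, …. The term +1 pays for the top scale r = 1. The induction is on the number of
-- doublings taking δ to 1/2.
theorem sum_filter_lt_le_of_card_scale_le (hK : 0 ≤ K) (ha : 2 ≤ a) (hg : ∀ u ∈ U, g u ≤ 1)
    (hc : ∀ r : ℝ, 0 < r → r ≤ 1 →
      ((U.filter fun u => r / 2 < g u ∧ g u ≤ r).card : ℝ) ≤ K * r ^ (-a)) (n : ℕ) :
    ∀ δ : ℝ, 0 < δ → 1 / 2 ≤ 2 ^ n * δ →
      ∑ u ∈ U.filter (fun u => δ < g u), g u ≤ K * (2 * (2 * δ) ^ (1 - a) + 1) := by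
  have hscale : ∀ r : ℝ, 0 < r → r ≤ 1 →
      ∑ u ∈ U.filter (fun u => r / 2 < g u ∧ g u ≤ r), g u ≤ K * r ^ (1 - a) := by
    intro r hr hr1
    calc _ ≤ ∑ _u ∈ U.filter (fun u => r / 2 < g u ∧ g u ≤ r), r :=
          Finset.sum_le_sum fun u hu => (Finset.mem_filter.1 hu).2.2
      _ ≤ K * r ^ (-a) * r := by
          rw [Finset.sum_const, nsmul_eq_mul]
          exact mul_le_mul_of_nonneg_right (hc r hr hr1) hr.le
      _ = K * r ^ (1 - a) := by
          rw [mul_assoc, ← Real.rpow_add_one hr.ne']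
          ring_nf
  have hlarge : ∀ δ : ℝ, 1 / 2 ≤ δ →
      ∑ u ∈ U.filter (fun u => δ < g u), g u ≤ K * (2 * (2 * δ) ^ (1 - a) + 1) := by
    intro δ hδ
    have h1 := hscale 1 one_pos le_rfl
    rw [Real.one_rpow, mul_one] at h1
    refine le_trans (le_trans (Finset.sum_le_sum_of_subset_of_nonneg ?_ ?_) h1) ?_
    · intro u hu
      obtain ⟨h2, h3⟩ := Finset.mem_filter.1 hu
      exact Finset.mem_filter.2 ⟨h2, hδ.trans_lt h3, hg u h2⟩
    · intro u hu _
      linarith [(Finset.mem_filter.1 hu).2.1]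
    · have : 0 ≤ (2 * δ) ^ (1 - a) := Real.rpow_nonneg (by linarith) _
      nlinarith
  induction n with
  | zero => exact fun δ _ h => hlarge δ (by simpa using h)
  | succ n ih =>
    intro δ hδ h
    rcases le_or_gt (1 / 2) δ with h1 | h1
    · exact hlarge δ h1
    · have h2 := ih (2 * δ) (by linarith) (by rw [pow_succ] at h; linarith)
      have h3 := hscale (2 * δ) (by linarith) (by linarith)
      have hsplit : ∑ u ∈ U.filter (fun u => δ < g u), g u
          = ∑ u ∈ U.filter (fun u => 2 * δ / 2 < g u ∧ g u ≤ 2 * δ), g u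
            + ∑ u ∈ U.filter (fun u => 2 * δ < g u), g u := by
        rw [← Finset.sum_filter_add_sum_filter_not (U.filter fun u => δ < g u)
          (fun u => g u ≤ 2 * δ), Finset.filter_filter, Finset.filter_filter]
        congr 2
        · ext u
          simp
        · ext u
          simp only [Finset.mem_filter, not_le]
          exact ⟨fun hu => ⟨hu.1, hu.2.2⟩, fun hu => ⟨hu.1, by linarith [hu.2], hu.2⟩⟩
      have h4 : 2 * (2 * (2 * δ)) ^ (1 - a) ≤ (2 * δ) ^ (1 - a) := by
        rw [Real.mul_rpow (by norm_num) (by linarith : (0 : ℝ) ≤ 2 * δ), ← mul_assoc]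
        refine mul_le_of_le_one_left (Real.rpow_nonneg (by linarith) _) ?_
        have : (2 : ℝ) ^ (1 - a) ≤ 2 ^ (-1 : ℝ) :=
          Real.rpow_le_rpow_of_exponent_le (by norm_num) (by linarith)
        rw [Real.rpow_neg_one] at this
        linarith
      rw [hsplit]
      nlinarith

open Classical in
/-- Peeling: a bound on the number of terms at every scale bounds the sum. -/
theorem sum_le_of_card_scale_le (hK : 0 ≤ K) (ha : 2 ≤ a) (hg : ∀ u ∈ U, g u ≤ 1)
    (hc : ∀ r : ℝ, 0 < r → r ≤ 1 →
      ((U.filter fun u => r / 2 < g u ∧ g u ≤ r).card : ℝ) ≤ K * r ^ (-a)) {δ : ℝ} (hδ : 0 < δ) :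
    ∑ u ∈ U, g u ≤ δ * U.card + K * (2 * (2 * δ) ^ (1 - a) + 1) := by
  obtain ⟨n, hn⟩ := pow_unbounded_of_one_lt (1 / 2 / δ) (one_lt_two (α := ℝ))
  have h1 := sum_filter_lt_le_of_card_scale_le hK ha hg hc n δ hδ ((div_lt_iff₀ hδ).1 hn).le
  rw [← Finset.sum_filter_add_sum_filter_not U (fun u => δ < g u), add_comm]
  refine add_le_add ?_ h1
  calc _ ≤ ∑ _u ∈ U.filter (fun u => ¬ δ < g u), δ :=
        Finset.sum_le_sum fun u hu => not_lt.1 (Finset.mem_filter.1 hu).2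
    _ ≤ δ * U.card := by
        rw [Finset.sum_const, nsmul_eq_mul, mul_comm]
        exact mul_le_mul_of_nonneg_left (by exact_mod_cast Finset.card_filter_le _ _) hδ.le

end Scales

/-- The choice of the threshold scale. -/
theorem threshold_bound {m B a β : ℝ} (hm : 0 ≤ m) (hB : 0 ≤ B) (ha : 2 ≤ a) (hβ : 0 < β)
    (hβ1 : β ≤ 1) (hβa : β = (6 * B) ^ (1 / a)) :
    β / 2 * m + m * B * (2 * (2 * (β / 2)) ^ (1 - a) + 1) ≤ m * β := by
  have ha0 : a ≠ 0 := by linarith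
  have h1 : β ^ a = 6 * B := by
    rw [hβa, ← Real.rpow_mul (by linarith), one_div, inv_mul_cancel₀ ha0, Real.rpow_one]
  have h2 : β ^ a * β ^ (1 - a) = β := by
    rw [← Real.rpow_add hβ]
    simp
  have h3 : β ^ a ≤ β := by
    simpa using Real.rpow_le_rpow_of_exponent_ge hβ hβ1 (by linarith : 1 ≤ a)
  have e : 2 * (β / 2) = β := by ring
  rw [e]
  -- The factor 6 in β makes the three terms β/2, β/3 and at most β/6.
  have h4 : B * β ^ (1 - a) = β / 6 := by
    rw [h1] at h2
    linarith
  have h5 : B ≤ β / 6 := by linarith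
  calc _ = m * (β / 2 + 2 * (B * β ^ (1 - a)) + B) := by ring
    _ ≤ m * β := mul_le_mul_of_nonneg_left (by rw [h4]; linarith) hm

theorem sum_sqrt_two_pow_le (n : ℕ) :
    ∑ i ∈ Finset.range (n + 1), Real.sqrt (2 ^ i) ≤ 4 * Real.sqrt (2 ^ n) := by
  induction n with
  | zero => simp
  | succ n ih =>
    rw [Finset.sum_range_succ, pow_succ, Real.sqrt_mul (by positivity)]
    -- The induction needs 4 + √2 ≤ 4√2.
    have h1 : (4 / 3 : ℝ) ≤ Real.sqrt 2 := Real.le_sqrt_of_sq_le (by norm_num)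
    nlinarith [Real.sqrt_nonneg (2 ^ n)]

/-- Summation over phases of doubling length. -/
theorem sum_phases_le {L : ℕ} {m : ℕ → ℝ} {t A a : ℝ} (hm : ∀ i, 0 ≤ m i)
    (hm2 : ∀ i, m i ≤ 2 ^ i) (ht : ∑ i ∈ Finset.range (L + 1), m i = t) (hL : 2 ^ L ≤ 2 * t)
    (ht0 : 0 < t) (hA : 0 ≤ A) (ha : 2 ≤ a) :
    ∑ i ∈ Finset.range (L + 1), m i * (A / m i) ^ (1 / a)
      ≤ (32 * A) ^ (1 / a) * t ^ ((a - 1) / a) := by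
  have ha0 : 0 < a := by linarith
  -- Jensen for s^(2/a), with weights m i / t at the points √(A / m i), keeps the factor 32 = 4²·2
  -- inside the power.
  have hconc : ConcaveOn ℝ (Ici 0) fun s : ℝ => s ^ (2 / a) :=
    Real.concaveOn_rpow (by positivity) ((div_le_one ha0).2 ha)
  have hJ := hconc.le_map_sum (t := Finset.range (L + 1)) (w := fun i => m i / t)
    (p := fun i => Real.sqrt (A / m i)) (fun i _ => div_nonneg (hm i) ht0.le)
    (by rw [← Finset.sum_div, ht, div_self ht0.ne']) (fun i _ => Real.sqrt_nonneg _)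
  simp only [smul_eq_mul] at hJ
  have h2a : ∀ s : ℝ, 0 ≤ s → Real.sqrt s ^ (2 / a) = s ^ (1 / a) := fun s hs => by
    rw [Real.sqrt_eq_rpow, ← Real.rpow_mul hs]
    congr 1
    ring
  have hsum : ∑ i ∈ Finset.range (L + 1), m i / t * Real.sqrt (A / m i)
      ≤ Real.sqrt (32 * A / t) := by
    calc _ ≤ ∑ i ∈ Finset.range (L + 1), Real.sqrt A / t * Real.sqrt (2 ^ i) := by
          refine Finset.sum_le_sum fun i _ => ?_
          have e : m i * Real.sqrt (A / m i) = Real.sqrt A * Real.sqrt (m i) := by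
            rcases (hm i).eq_or_lt with h0 | h0
            · simp [← h0]
            · rw [Real.sqrt_div hA]
              nth_rewrite 1 [← Real.mul_self_sqrt h0.le]
              field_simp [(Real.sqrt_pos.2 h0).ne']
          rw [div_mul_eq_mul_div, e, div_mul_eq_mul_div]
          exact div_le_div_of_nonneg_right (mul_le_mul_of_nonneg_left
            (Real.sqrt_le_sqrt (hm2 i)) (Real.sqrt_nonneg _)) ht0.le
      _ ≤ Real.sqrt A / t * (4 * Real.sqrt (2 ^ L)) := by
          rw [← Finset.mul_sum]
          exact mul_le_mul_of_nonneg_left (sum_sqrt_two_pow_le L) (by positivity)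
      _ ≤ Real.sqrt A / t * (4 * Real.sqrt (2 * t)) := by gcongr
      _ = Real.sqrt (32 * A / t) := by
          rw [← Real.sqrt_sq (by positivity : 0 ≤ Real.sqrt A / t * (4 * Real.sqrt (2 * t)))]
          congr 1
          rw [mul_pow, div_pow, mul_pow, Real.sq_sqrt hA, Real.sq_sqrt (by positivity)]
          field_simp
          ring
  have hfin := hJ.trans (Real.rpow_le_rpow (Finset.sum_nonneg fun i _ =>
    mul_nonneg (div_nonneg (hm i) ht0.le) (Real.sqrt_nonneg _)) hsum (by positivity : 0 ≤ 2 / a))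
  rw [h2a _ (by positivity)] at hfin
  calc _ = t * ∑ i ∈ Finset.range (L + 1), m i / t * Real.sqrt (A / m i) ^ (2 / a) := by
        rw [Finset.mul_sum]
        refine Finset.sum_congr rfl fun i _ => ?_
        rw [h2a _ (div_nonneg hA (hm i)), ← mul_assoc, mul_div_cancel₀ _ ht0.ne']
    _ ≤ t * (32 * A / t) ^ (1 / a) := mul_le_mul_of_nonneg_left hfin ht0.le
    _ = _ := by
        rw [Real.div_rpow (by positivity) ht0.le, sub_div, div_self ha0.ne',
          Real.rpow_sub ht0, Real.rpow_one]
        ring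

end Zooming

namespace Zooming

/-! ### The regret bound -/

open Classical in
/-- The number of near-optimal rounds of a phase at a given scale, whether or not the phase
is accurate. -/
theorem card_rounds_le_of_zoomingCovering {X : Type u} {D : X → X → ℝ≥0∞} {μ : X → ℝ}
    (hD : ∀ z, D z z = 0) (hμ : ∀ z, μ z ∈ Icc (0 : ℝ) 1) (hL : RelaxedLipschitz D μ) {c d : ℝ}
    (hcov : ZoomingCovering D μ c d) {x : ℕ → X} {y : ℕ → ℝ} (hpath : IsZoomingPath D x y)
    {i : ℕ} {Q : ℝ} (hQ : 288 * i ≤ Q)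
    (hQi : (∀ s, phase s = i → Accurate μ x y s) ∨ 2 ^ i ≤ Q) {U : Finset ℕ}
    (hU : ∀ s ∈ U, phase s = i) {r : ℝ} (hr : 0 < r) (hr1 : r ≤ 1) :
    ((U.filter fun s => r / 2 < badness μ (x s) ∧ badness μ (x s) ≤ r).card : ℝ)
      ≤ Q * c * r ^ (-(d + 2)) := by
  obtain ⟨F, hF1, hF2, hF3⟩ := hcov r hr hr1
  have hQ0 : 0 ≤ Q := le_trans (by positivity) hQ
  have e : Q * c * r ^ (-(d + 2)) = c * r ^ (-d) * (Q / r ^ 2) := by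
    rw [show -(d + 2) = -d - (2 : ℕ) by push_cast; ring, Real.rpow_sub hr, Real.rpow_natCast]
    ring
  have hcard : ((U.filter fun s => r / 2 < badness μ (x s) ∧ badness μ (x s) ≤ r).card : ℝ)
      ≤ F.card * (Q / r ^ 2) := by
    rcases hQi with hi | hi
    · refine le_trans (Nat.cast_le.2 (Finset.card_le_card fun s hs => ?_))
        ((card_rounds_le hD hμ hL hpath hi hr hF2 hF3 hU).trans ?_)
      · exact Finset.mem_filter.2 (Finset.mem_filter.1 hs)
      gcongr
    · rcases (U.filter fun s => r / 2 < badness μ (x s) ∧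
        badness μ (x s) ≤ r).eq_empty_or_nonempty with h0 | ⟨s, hs⟩
      · rw [h0]
        simp only [Finset.card_empty, Nat.cast_zero]
        positivity
      -- A nonempty scale needs at least one covering set, so even the trivial count 2^i fits the
      -- bound.
      · obtain ⟨S, hS, -⟩ : ∃ S ∈ F, x s ∈ S := by
          simpa using hF3 (show x s ∈ nearOptimal μ r from (Finset.mem_filter.1 hs).2)
        have h1 : (1 : ℝ) ≤ F.card := by exact_mod_cast Finset.card_pos.2 ⟨S, hS⟩
        have h2 : (U.filter fun s => r / 2 < badness μ (x s) ∧ badness μ (x s) ≤ r).card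
            ≤ 2 ^ i :=
          (Finset.card_le_card fun s hs => mem_phaseRounds_of_phase_eq
            (hU s (Finset.mem_filter.1 hs).1)).trans (card_phaseRounds_le i)
        have h3 : ((U.filter fun s => r / 2 < badness μ (x s) ∧ badness μ (x s) ≤ r).card : ℝ)
            ≤ 2 ^ i := by exact_mod_cast h2
        have h4 : Q ≤ Q / r ^ 2 := le_div_self hQ0 (by positivity) (pow_le_one₀ hr.le hr1)
        calc _ ≤ Q / r ^ 2 := h3.trans (hi.trans h4)
          _ ≤ F.card * (Q / r ^ 2) := le_mul_of_one_le_left (hQ0.trans h4) h1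
  rw [e]
  exact hcard.trans (mul_le_mul_of_nonneg_right hF1 (by positivity))

section Regret

variable {X : Type u} [MeasurableSpace X] {D : X → X → ℝ≥0∞} {P : Kernel X ℝ} [IsMarkovKernel P]
  {Ω : Type v} [mΩ : MeasurableSpace Ω] {Pr : Measure Ω} [IsProbabilityMeasure Pr]
  {ℱ : Filtration ℕ mΩ} {arm : ℕ → Ω → X} {reward : ℕ → Ω → ℝ}

theorem IsBanditProcess.integrable_badness (h : IsBanditProcess P Pr ℱ arm reward)
    (hP : ∀ x, P x (Icc 0 1) = 1) (s : ℕ) :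
    Integrable (fun ω => badness (meanPayoff P) (arm s ω)) Pr := by
  have hm : Measurable fun ω => badness (meanPayoff P) (arm s ω) :=
    ((measurable_meanPayoff P).comp ((h.measurable_arm s).mono (ℱ.le s) le_rfl)).const_sub _
  exact Integrable.of_mem_Icc 0 1 hm.aemeasurable (ae_of_all _ fun ω =>
    ⟨badness_nonneg (meanPayoff_mem_Icc hP) _, badness_le_one (meanPayoff_mem_Icc hP) _⟩)

/-- The expected regret of a phase, possibly stopped early. -/
theorem IsZoomingProcess.integral_phase_le (h : IsZoomingProcess D P Pr ℱ arm reward)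
    (hD : ∀ z, D z z = 0) (hP : ∀ x, P x (Icc 0 1) = 1)
    (hL : RelaxedLipschitz D (meanPayoff P)) {c d : ℝ} (hc : 0 < c) (hd : 0 ≤ d)
    (hcov : ZoomingCovering D (meanPayoff P) c d) {i : ℕ} (hi : 1 ≤ i) {U : Finset ℕ}
    (hU : ∀ s ∈ U, phase s = i) :
    ∫ ω, ∑ s ∈ U, badness (meanPayoff P) (arm s ω) ∂Pr
      ≤ U.card * (6 * (289 * c * i) / U.card) ^ (1 / (d + 2)) := by
  have hμ := meanPayoff_mem_Icc hP
  have hint : Integrable (fun ω => ∑ s ∈ U, badness (meanPayoff P) (arm s ω)) Pr :=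
    integrable_finsetSum _ fun s _ => h.integrable_badness hP s
  rcases U.eq_empty_or_nonempty with rfl | hne
  · simp
  have hm : (0 : ℝ) < U.card := by exact_mod_cast hne.card_pos
  have hi0 : (1 : ℝ) ≤ i := by exact_mod_cast hi
  set m : ℝ := (U.card : ℝ) with hmdef
  obtain ⟨B, hB⟩ : ∃ B, B = 289 * c * i / m := ⟨_, rfl⟩
  have hB0 : 0 < B := by rw [hB]; positivity
  have hmB : m * B = 289 * c * i := by rw [hB]; field_simp
  obtain ⟨β, hβ⟩ : ∃ β, β = (6 * B) ^ (1 / (d + 2)) := ⟨_, rfl⟩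
  have hβ0 : 0 < β := hβ ▸ Real.rpow_pos_of_pos (by positivity) _
  rw [mul_div_assoc, ← hB, ← hβ]
  rcases le_or_gt β 1 with hβ1 | hβ1
  · let E : Set Ω := toMeasurable Pr {ω | ∃ t, phase t = i ∧
      ¬ Accurate (meanPayoff P) (fun t => arm t ω) (fun t => reward t ω) t}
    have hE : MeasurableSet E := measurableSet_toMeasurable _ _
    let Q : Ω → ℝ := fun ω => 288 * i + E.indicator (fun _ => (2 : ℝ) ^ i) ω
    let G : ℝ := c * (2 * (2 * (β / 2)) ^ (1 - (d + 2)) + 1)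
    have hG : 0 ≤ G := by positivity
    have hQint : Integrable Q Pr :=
      (integrable_const _).add ((integrable_const _).indicator hE)
    have hEQ : ∫ ω, Q ω ∂Pr ≤ 289 * i := by
      have hPE : Pr.real E ≤ 1 / 2 ^ i := by
        refine ENNReal.toReal_le_of_le_ofReal (by positivity) ?_
        rw [measure_toMeasurable]
        exact h.measure_not_accurate_le hP hi
      have e : ∫ ω, Q ω ∂Pr = 288 * i + Pr.real E * 2 ^ i := by
        rw [integral_add (integrable_const _) ((integrable_const _).indicator hE),
          integral_indicator_const _ hE]
        simp
      have h1 : Pr.real E * 2 ^ i ≤ 1 := by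
        rwa [le_div_iff₀ (by positivity)] at hPE
      rw [e]
      linarith
    have hpt : ∀ ω, ∑ s ∈ U, badness (meanPayoff P) (arm s ω) ≤ β / 2 * m + Q ω * G := by
      intro ω
      have hQ1 : 288 * (i : ℝ) ≤ Q ω :=
        le_add_of_nonneg_right (indicator_nonneg (fun _ _ => by positivity) _)
      have hQ2 : (∀ s, phase s = i →
          Accurate (meanPayoff P) (fun t => arm t ω) (fun t => reward t ω) s) ∨
          2 ^ i ≤ Q ω := by
        by_cases hω : ω ∈ E
        · right
          simp only [Q, indicator_of_mem hω]
          exact le_add_of_nonneg_left (by positivity)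
        · left
          intro s hs
          by_contra hacc
          exact hω (subset_toMeasurable _ _ ⟨s, hs, hacc⟩)
      have hQ0 : 0 ≤ Q ω := le_trans (by positivity) hQ1
      have := sum_le_of_card_scale_le (U := U)
        (g := fun s => badness (meanPayoff P) (arm s ω)) (mul_nonneg hQ0 hc.le)
        (by linarith : 2 ≤ d + 2) (fun s _ => badness_le_one hμ _)
        (fun r hr hr1 => card_rounds_le_of_zoomingCovering hD hμ hL hcov (h.path ω) hQ1 hQ2
          hU hr hr1) (half_pos hβ0)
      rwa [mul_assoc (Q ω)] at this
    calc _ ≤ ∫ ω, (β / 2 * m + Q ω * G) ∂Pr :=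
          integral_mono hint ((integrable_const _).add (hQint.mul_const _)) hpt
      _ = β / 2 * m + (∫ ω, Q ω ∂Pr) * G := by
          rw [integral_add (integrable_const _) (hQint.mul_const _), integral_const,
            integral_mul_const]
          simp
      _ ≤ β / 2 * m + 289 * i * G := by gcongr
      _ = β / 2 * m + m * B * (2 * (2 * (β / 2)) ^ (1 - (d + 2)) + 1) := by
          rw [hmB]
          ring
      _ ≤ m * β := threshold_bound hm.le hB0.le (by linarith) hβ0 hβ1 hβ
  -- For β > 1 the trivial bound of 1 per round suffices.
  · calc _ ≤ ∫ _, m ∂Pr := by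
          refine integral_mono hint (integrable_const _) fun ω => ?_
          refine (Finset.sum_le_sum fun s _ => badness_le_one hμ (arm s ω)).trans ?_
          simp [hmdef]
      _ = m := by simp
      _ ≤ m * β := le_mul_of_one_le_right hm.le hβ1.le

/-- Uses t + 1 ≤ t² and 2/log 2 < 3. -/
theorem log_two_succ_le {t : ℕ} (ht : 2 ≤ t) : (Nat.log 2 (t + 1) : ℝ) ≤ 3 * Real.log t := by
  have ht0 : (2 : ℝ) ≤ t := by exact_mod_cast ht
  have h1 : (2 : ℝ) ^ Nat.log 2 (t + 1) ≤ t ^ 2 := by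
    have : 2 ^ Nat.log 2 (t + 1) ≤ t + 1 := Nat.pow_log_le_self 2 (by omega)
    have h2 : (2 : ℝ) ^ Nat.log 2 (t + 1) ≤ t + 1 := by exact_mod_cast this
    nlinarith
  have h3 := Real.log_le_log (by positivity) h1
  rw [Real.log_pow, Real.log_pow] at h3
  have h4 := Real.log_two_gt_d9
  push_cast at h3
  nlinarith [Nat.cast_nonneg (α := ℝ) (Nat.log 2 (t + 1))]

theorem IsBanditProcess.regret_eq (h : IsBanditProcess P Pr ℱ arm reward)
    (hP : ∀ x, P x (Icc 0 1) = 1) (t : ℕ) :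
    regret (meanPayoff P) Pr arm t
      = ∑ s ∈ Finset.range t, ∫ ω, badness (meanPayoff P) (arm s ω) ∂Pr := by
  have hμint : ∀ s, Integrable (fun ω => meanPayoff P (arm s ω)) Pr := fun s =>
    Integrable.of_mem_Icc 0 1 ((measurable_meanPayoff P).comp
      ((h.measurable_arm s).mono (ℱ.le s) le_rfl)).aemeasurable
      (ae_of_all _ fun ω => meanPayoff_mem_Icc hP _)
  have e : ∀ s, ∫ ω, badness (meanPayoff P) (arm s ω) ∂Pr
      = (⨆ x, meanPayoff P x) - ∫ ω, meanPayoff P (arm s ω) ∂Pr := fun s => by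
    unfold badness
    rw [integral_sub (integrable_const _) (hμint s)]
    simp
  rw [regret, integral_finsetSum _ fun s _ => hμint s]
  simp_rw [e]
  rw [Finset.sum_sub_distrib]
  simp

/-- The regret bound under the relaxed Lipschitz condition. -/
theorem IsZoomingProcess.regret_le (h : IsZoomingProcess D P Pr ℱ arm reward)
    (hD : ∀ z, D z z = 0) (hP : ∀ x, P x (Icc 0 1) = 1)
    (hL : RelaxedLipschitz D (meanPayoff P)) {c d : ℝ} (hc : 0 < c) (hd : 0 ≤ d)
    (hcov : ZoomingCovering D (meanPayoff P) c d) {t : ℕ} (ht : 2 ≤ t) :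
    regret (meanPayoff P) Pr arm t
      ≤ (166464 * (c * Real.log t)) ^ (1 / (d + 2)) * (t : ℝ) ^ ((d + 1) / (d + 2)) := by
  have ht0 : (0 : ℝ) < t := by positivity
  set L := Nat.log 2 (t + 1) with hLdef
  set U : ℕ → Finset ℕ := fun i => (Finset.range t).filter fun s => phase s = i with hUdef
  have hmaps : ∀ s ∈ Finset.range t, phase s ∈ Finset.range (L + 1) := fun s hs => by
    have : phase s ≤ L := Nat.log_mono_right (by have := Finset.mem_range.1 hs; omega)
    exact Finset.mem_range.2 (by omega)
  have hphase : ∀ i ∈ Finset.range (L + 1),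
      ∑ s ∈ U i, ∫ ω, badness (meanPayoff P) (arm s ω) ∂Pr
        ≤ (U i).card * (6 * (289 * c * L) / (U i).card) ^ (1 / (d + 2)) := by
    intro i hi
    have hU : ∀ s ∈ U i, phase s = i := fun s hs => (Finset.mem_filter.1 hs).2
    rcases (U i).eq_empty_or_nonempty with h0 | ⟨s, hs⟩
    · simp [h0]
    rw [← integral_finsetSum _ fun s _ => h.integrable_badness hP s]
    refine (h.integral_phase_le hD hP hL hc hd hcov (hU s hs ▸ one_le_phase s) hU).trans ?_
    have hiL : (i : ℝ) ≤ L := by exact_mod_cast Nat.lt_succ_iff.1 (Finset.mem_range.1 hi)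
    gcongr
  have hsumcard : ∑ i ∈ Finset.range (L + 1), ((U i).card : ℝ) = t := by
    have := Finset.card_eq_sum_card_fiberwise (f := phase) (t := Finset.range (L + 1)) hmaps
    rw [Finset.card_range] at this
    exact_mod_cast this.symm
  have hLt : (2 : ℝ) ^ L ≤ 2 * t := by
    have h1 : 2 ^ L ≤ t + 1 := Nat.pow_log_le_self 2 (by omega)
    have h2 : (2 : ℝ) ^ L ≤ t + 1 := by exact_mod_cast h1
    have h3 : (2 : ℝ) ≤ t := by exact_mod_cast ht
    linarith
  have hcard : ∀ i, ((U i).card : ℝ) ≤ 2 ^ i := fun i => by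
    exact_mod_cast (Finset.card_le_card fun s hs =>
      mem_phaseRounds_of_phase_eq (Finset.mem_filter.1 hs).2).trans (card_phaseRounds_le i)
  calc regret (meanPayoff P) Pr arm t
      = ∑ i ∈ Finset.range (L + 1), ∑ s ∈ U i, ∫ ω, badness (meanPayoff P) (arm s ω) ∂Pr := by
        rw [h.regret_eq hP, Finset.sum_fiberwise_of_maps_to hmaps]
    _ ≤ ∑ i ∈ Finset.range (L + 1),
        ((U i).card : ℝ) * (6 * (289 * c * L) / (U i).card) ^ (1 / (d + 2)) :=
        Finset.sum_le_sum hphase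
    _ ≤ (32 * (6 * (289 * c * L))) ^ (1 / (d + 2)) * (t : ℝ) ^ ((d + 2 - 1) / (d + 2)) :=
        sum_phases_le (fun i => by positivity) hcard hsumcard hLt ht0 (by positivity)
          (by linarith)
    _ ≤ _ := by
        rw [show d + 2 - 1 = d + 1 by ring]
        refine mul_le_mul_of_nonneg_right (Real.rpow_le_rpow (by positivity) ?_ (by positivity))
          (by positivity)
        -- 166464 = 32·6·289·3.
        nlinarith [mul_le_mul_of_nonneg_left (log_two_succ_le ht) hc.le]

end Regret

/-- Any arm within ε of the supremum serves as the reference arm. -/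
theorem relaxedLipschitz_of_lipschitzWith {X : Type u} [MetricSpace X] [Nonempty X] {μ : X → ℝ}
    (h : LipschitzWith 1 μ) :
    RelaxedLipschitz (fun x y : X => edist x y) μ := by
  intro ε hε
  obtain ⟨xs, hxs⟩ := exists_lt_of_lt_ciSup (sub_lt_self (⨆ z, μ z) hε)
  refine ⟨xs, fun x => ?_⟩
  have h1 := h.dist_le_mul x xs
  rw [NNReal.coe_one, one_mul, Real.dist_eq, abs_le] at h1
  change _ ≤ edist x xs + _
  rw [edist_dist, ← ENNReal.ofReal_add dist_nonneg hε.le]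
  refine ENNReal.ofReal_le_ofReal ?_
  unfold badness
  linarith [h1.1]

end Zooming

theorem mainTheorem2 :
    ∃ C : ℝ, 0 < C ∧
      -- the Lipschitz bandit problem on a metric space
      (∀ (X : Type u) [MetricSpace X] [MeasurableSpace X] (P : Kernel X ℝ) [IsMarkovKernel P],
        (∀ x, P x (Set.Icc 0 1) = 1) →
        LipschitzWith 1 (Zooming.meanPayoff P) →
        ∀ c d : ℝ, 0 < c →
        Zooming.IsZoomingDim (fun x y : X => edist x y) (Zooming.meanPayoff P) c d →
        ∀ (Ω : Type v) [mΩ : MeasurableSpace Ω] (Pr : Measure Ω) [IsProbabilityMeasure Pr]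
          (ℱ : Filtration ℕ mΩ) (arm : ℕ → Ω → X) (reward : ℕ → Ω → ℝ),
        Zooming.IsZoomingProcess (fun x y : X => edist x y) P Pr ℱ arm reward →
        ∀ t : ℕ, 2 ≤ t →
          Zooming.regret (Zooming.meanPayoff P) Pr arm t ≤
            (C * (c * Real.log t)) ^ (1 / (d + 2)) * (t : ℝ) ^ ((d + 1) / (d + 2))) ∧
      -- no triangle inequality, and the relaxed Lipschitz condition
      (∀ (X : Type u) [MeasurableSpace X] (D : X → X → ℝ≥0∞) (P : Kernel X ℝ) [IsMarkovKernel P],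
        Zooming.IsQuasiMetric D →
        (∀ x, P x (Set.Icc 0 1) = 1) →
        Zooming.RelaxedLipschitz D (Zooming.meanPayoff P) →
        ∀ c d : ℝ, 0 < c →
        Zooming.IsZoomingDim D (Zooming.meanPayoff P) c d →
        ∀ (Ω : Type v) [mΩ : MeasurableSpace Ω] (Pr : Measure Ω) [IsProbabilityMeasure Pr]
          (ℱ : Filtration ℕ mΩ) (arm : ℕ → Ω → X) (reward : ℕ → Ω → ℝ),
        Zooming.IsZoomingProcess D P Pr ℱ arm reward →
        ∀ t : ℕ, 2 ≤ t →
          Zooming.regret (Zooming.meanPayoff P) Pr arm t ≤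
            (C * (c * Real.log t)) ^ (1 / (d + 2)) * (t : ℝ) ^ ((d + 1) / (d + 2))) := by
  refine ⟨166464, by norm_num, ?_, ?_⟩
  · intro X _ _ P _ hP hLip c d hc hdim Ω mΩ Pr _ ℱ arm reward h t ht
    obtain ⟨ω⟩ := nonempty_of_isProbabilityMeasure Pr
    have : Nonempty X := ⟨arm 0 ω⟩
    exact h.regret_le (fun z => edist_self z) hP
      (Zooming.relaxedLipschitz_of_lipschitzWith hLip) hc
      hdim.1.1 hdim.1.2 ht
  · intro X _ D P _ hD hP hL c d hc hdim Ω mΩ Pr _ ℱ arm reward h t ht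
    exact h.regret_le hD.self hP hL hc hdim.1.1 hdim.1.2 ht
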